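/- Let $\mu$ be a $\sigma$-finite positive measure on a non-empty set $X$, and let $M(X,\mu)$ be the space of (a.e. classes of) complex measurable functions on $X$. Let $L\subseteq M(X,\mu)$ be a Banach function space, i.e. a linear subspace with a complete norm such that $f\in L$, $g\in M(X,\mu)$ and $|g|\le|f|$ a.e. imply $g\in L$ and $\|g\|\le\|f\|$. Assume that $\dim L>1$, that $X$ is the carrier of $L$ (there is no set of positive measure on which every $f\in L$ vanishes a.e.), and that the norm of $L$ is weakly Fatou: there is a finite constant $k\ge 1$ such that $\|f\|\le k\,\sup_\tau\|f_\tau\|$ whenever $(f_\tau)$ is an upwards directed system of non-negative elements of $L$ with supremum $f$ in $L$. Let $L'$ be the associate space, that is, the space of all $g\in M(X,\mu)$ for which $\varphi_g(f)=\int_X fg\,d\mu$ defines a bounded linear functional on $L$; it is regarded as a subspace of the dual of $L$ via $g\mapsto\varphi_g$. Write $r(T)$ for the spectral radius of a bounded operator $T$ on $L$. Let $K_1,\dots,K_n$ be positive kernel operators on $L$: each maps non-negative elements of $L$ to non-negative ones, and there is a $\mu\times\mu$-measurable function $k_i$ on $X\times X$ such that, for every $f\in L$ and almost every $x$, $\int_X|k_i(x,y)f(y)|\,d\mu(y)<\infty$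 and $(K_if)(x)=\int_X k_i(x,y)f(y)\,d\mu(y)$. Let $K_i'$ be the restriction to $L'$ of the adjoint of $K_i$. Assume that there are functions $f_1,\dots,f_n\in L$ and $g_1,\dots,g_n\in L'$, strictly positive almost everywhere, and a function $h$ such that, for $i=1,\dots,n$, $$K_if_i=r(K_i)f_i,\qquad K_i'g_i=r(K_i)g_i,\qquad f_ig_i=h,\qquad \int_X h\,d\mu=1 .$$ (a) For $i=1,\dots,n$ let $p_i(z)=\sum_{k\ge0}a_{i,k}z^k$ be a power series with coefficients $a_{i,k}\ge0$ and radius of convergence greater than $r(K_i)$. Then the series $p_i(K_i)=\sum_k a_{i,k}K_i^k$ (in operator norm) and $p_i(r(K_i))$ converge, and $$r\bigl(p_1(K_1)+\cdots+p_n(K_n)\bigr)\ \ge\ p_1(r(K_1))+\cdots+p_n(r(K_n)).$$ (b) In particular, if $s_1,\dots,s_n$ are real numbers with $s_i>r(K_i)$ for all $i$, then every $s_i-K_i$ is invertible and $$r\bigl((s_1-K_1)^{-1}+\cdots+(s_n-K_n)^{-1}\bigr)\ \ge\ \frac1{s_1-r(K_1)}+\cdots+\frac1{s_n-r(K_n)}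 .$$ -/

import Mathlib

open MeasureTheory
open scoped ComplexOrder ENNReal

noncomputable section

/-- A Banach function space over `(X, μ)`: a linear subspace of the space `M(X, μ)` of
(a.e. classes of) complex measurable functions, with a complete norm, such that `f ∈ L`,
`g ∈ M(X, μ)` and `|g| ≤ |f|` a.e. imply `g ∈ L` and `‖g‖ ≤ ‖f‖`. -/
structure BanachFunctionSpace {X : Type*} [MeasurableSpace X] (μ : Measure X) where
  /-- the underlying linear subspace of `M(X, μ)` -/
  toSubmodule : Submodule ℂ (X →ₘ[μ] ℂ)
  /-- the norm -/
  toNorm : Norm toSubmodule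
  core : NormedSpace.Core ℂ toSubmodule
  complete : letI := NormedAddCommGroup.ofCore core; CompleteSpace toSubmodule
  ideal : ∀ (f : toSubmodule) (g : X →ₘ[μ] ℂ),
    (∀ᵐ x ∂μ, ‖g x‖ ≤ ‖(f : X →ₘ[μ] ℂ) x‖) →
      ∃ hg : g ∈ toSubmodule, ‖(⟨g, hg⟩ : toSubmodule)‖ ≤ ‖f‖

namespace BanachFunctionSpace

variable {X : Type*} [MeasurableSpace X] {μ : Measure X}

/-- The elements of a Banach function space, as a type. -/
def Elem (L : BanachFunctionSpace μ) : Type _ := L.toSubmodule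

instance : CoeSort (BanachFunctionSpace μ) (Type _) := ⟨Elem⟩

variable (L : BanachFunctionSpace μ)

/-- An element of `L` as a class in `M(X, μ)`. -/
@[coe] def Elem.toFun {L : BanachFunctionSpace μ} (f : L) : X →ₘ[μ] ℂ := f.1

instance : CoeOut L (X →ₘ[μ] ℂ) := ⟨Elem.toFun⟩

instance : NormedAddCommGroup L :=
  letI := L.toNorm
  (NormedAddCommGroup.ofCore L.core : NormedAddCommGroup L.toSubmodule)

instance : NormedSpace ℂ L where
  toModule := L.toSubmodule.module
  norm_smul_le c f :=
    letI := L.toNorm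
    (L.core.norm_smul c f).le

instance : CompleteSpace L := L.complete

/-- The order of `L`: for complex `a`, `b`, the relation `a ≤ b` means that `b - a` is real and
non-negative, so `f ≤ g` in `L` means that `g - f` is real and non-negative a.e. -/
instance : PartialOrder L := PartialOrder.lift (Elem.toFun (L := L)) Subtype.val_injective

/-- `X` is the carrier of `L`: no set of positive measure on which all elements of `L` vanish. -/
def HasFullCarrier : Prop :=
  ¬ ∃ Y : Set X, MeasurableSet Y ∧ 0 < μ Y ∧ ∀ f : L, ∀ᵐ x ∂μ, x ∈ Y → (f : X →ₘ[μ] ℂ) x = 0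

/-- The norm is weakly Fatou: there is a finite `k ≥ 1` such that `0 ≤ f_τ ↑ f` in `L` (an upwards
directed system with supremum `f`) implies `‖f‖ ≤ k * sup ‖f_τ‖`; the supremum is expressed
through the upper bounds `C` of the norms. -/
def IsWeaklyFatou : Prop :=
  ∃ k : ℝ, 1 ≤ k ∧ ∀ (D : Set L) (f : L), D.Nonempty → DirectedOn (· ≤ ·) D →
    (∀ u ∈ D, 0 ≤ u) → IsLUB D f → ∀ C : ℝ, (∀ u ∈ D, ‖u‖ ≤ C) → ‖f‖ ≤ k * C

/-- The associate space (Köthe dual) `L'`: all `g ∈ M(X, μ)` such that `f ↦ ∫ f g dμ` is a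
(well-defined and) bounded linear functional on `L`. -/
def associate : Submodule ℂ (X →ₘ[μ] ℂ) where
  carrier := {g | (∀ f : L, Integrable (fun x => (f : X →ₘ[μ] ℂ) x * g x) μ) ∧
    ∃ C : ℝ, ∀ f : L, ‖∫ x, (f : X →ₘ[μ] ℂ) x * g x ∂μ‖ ≤ C * ‖f‖}
  zero_mem' := by
    have h0 : ∀ f : L,
        (fun x => (f : X →ₘ[μ] ℂ) x * (0 : X →ₘ[μ] ℂ) x) =ᵐ[μ] fun _ => (0 : ℂ) := by
      intro f
      filter_upwards [AEEqFun.coeFn_zero (α := X) (β := ℂ) (μ := μ)] with x hx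
      simp [hx]
    refine ⟨fun f => (integrable_congr (h0 f)).2 (integrable_zero _ _ _), 0, fun f => ?_⟩
    rw [integral_congr_ae (h0 f)]
    simp
  add_mem' := by
    rintro a b ⟨ha, C, hC⟩ ⟨hb, C', hC'⟩
    have h0 : ∀ f : L, (fun x => (f : X →ₘ[μ] ℂ) x * (a + b : X →ₘ[μ] ℂ) x) =ᵐ[μ]
        fun x => (f : X →ₘ[μ] ℂ) x * a x + (f : X →ₘ[μ] ℂ) x * b x := by
      intro f
      filter_upwards [AEEqFun.coeFn_add a b] with x hx
      simp [hx, mul_add]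
    refine ⟨fun f => (integrable_congr (h0 f)).2 ((ha f).add (hb f)), C + C', fun f => ?_⟩
    rw [integral_congr_ae (h0 f), integral_add (ha f) (hb f), add_mul]
    exact (norm_add_le _ _).trans (add_le_add (hC f) (hC' f))
  smul_mem' := by
    rintro c a ⟨ha, C, hC⟩
    have h0 : ∀ f : L, (fun x => (f : X →ₘ[μ] ℂ) x * (c • a : X →ₘ[μ] ℂ) x) =ᵐ[μ]
        fun x => c * ((f : X →ₘ[μ] ℂ) x * a x) := by
      intro f
      filter_upwards [AEEqFun.coeFn_smul c a] with x hx
      simp [hx, mul_left_comm]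
    refine ⟨fun f => (integrable_congr (h0 f)).2 ((ha f).const_mul c), ‖c‖ * C, fun f => ?_⟩
    rw [integral_congr_ae (h0 f), integral_const_mul, norm_mul, mul_assoc]
    exact mul_le_mul_of_nonneg_left (hC f) (norm_nonneg c)

/-- The bounded functional `φ_g (f) = ∫ f g dμ` on `L` given by `g ∈ L'`; through the injection
`g ↦ φ_g` the associate space is regarded as a subspace of the dual of `L`. -/
def functional (g : L.associate) : L →L[ℂ] ℂ :=
  LinearMap.mkContinuousOfExistsBound
    { toFun := fun f : L => ∫ x, (f : X →ₘ[μ] ℂ) x * (g : X →ₘ[μ] ℂ) x ∂μ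
      map_add' := by
        intro f f'
        rw [← integral_add (g.2.1 f) (g.2.1 f')]
        refine integral_congr_ae ?_
        filter_upwards [AEEqFun.coeFn_add f.toFun f'.toFun] with x hx
        have : ((f + f' : L) : X →ₘ[μ] ℂ) x = (f : X →ₘ[μ] ℂ) x + (f' : X →ₘ[μ] ℂ) x := hx
        simp only [this, add_mul]
      map_smul' := by
        intro c f
        rw [RingHom.id_apply, smul_eq_mul, ← integral_const_mul]
        refine integral_congr_ae ?_
        filter_upwards [AEEqFun.coeFn_smul c f.toFun] with x hx
        have : ((c • f : L) : X →ₘ[μ] ℂ) x = c * (f : X →ₘ[μ] ℂ) x := hx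
        simp only [this, mul_assoc] }
    g.2.2

variable {L}

/-- The adjoint `K^*` on the dual of `L`, `K^* φ = φ ∘ K`. The operator `K'` is its restriction
to the associate space, so `K' g = g'` in `L'` means `K^* φ_g = φ_{g'}`. -/
def adjoint (K : L →L[ℂ] L) : (L →L[ℂ] ℂ) →L[ℂ] (L →L[ℂ] ℂ) := ContinuousLinearMap.precomp ℂ K

/-- Positive operators: `K f ≥ 0` whenever `f ≥ 0`. -/
def IsPositiveOperator (K : L →L[ℂ] L) : Prop := ∀ f : L, 0 ≤ f → 0 ≤ K f

/-- Kernel operators: `(K f)(x) = ∫ k(x, y) f(y) dμ(y)` for almost all `x`, with absolute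
convergence, for a `μ × μ`-measurable function `k`. -/
def IsKernelOperator (K : L →L[ℂ] L) : Prop :=
  ∃ k : X × X → ℂ, AEStronglyMeasurable k (μ.prod μ) ∧
    ∀ f : L, ∀ᵐ x ∂μ, Integrable (fun y => k (x, y) * (f : X →ₘ[μ] ℂ) y) μ ∧
      (K f : X →ₘ[μ] ℂ) x = ∫ y, k (x, y) * (f : X →ₘ[μ] ℂ) y ∂μ

/-- A function that is strictly positive almost everywhere. -/
def IsStrictlyPositive (f : X →ₘ[μ] ℂ) : Prop := ∀ᵐ x ∂μ, 0 < f x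

/-- The spectral radius as a real number (it is finite for a bounded operator). -/
def specRadius (T : L →L[ℂ] L) : ℝ := (spectralRadius ℂ T).toReal

/-- The coefficient sequences of the elements of `P_+(T)`: power series `∑ a_k z^k` with
`a_k ≥ 0` and radius of convergence greater than the spectral radius of `T`. -/
def MemPPlus (T : L →L[ℂ] L) (a : ℕ → ℝ) : Prop :=
  (∀ k, 0 ≤ a k) ∧
    spectralRadius ℂ T < (FormalMultilinearSeries.ofScalars ℂ fun k => (a k : ℂ)).radius

end BanachFunctionSpace

end

/-!
The operators `A i = p i (K i)` are positive and inherit the strictly positive eigenvectors `f i`,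
`g i` of `K i` and its adjoint, with eigenvalue `q i = p i (r (K i))`. So it suffices to show
`∑ q i ≤ r (∑ A i)` for positive operators with two-sided eigenvectors whose products `f i * g i`
are one and the same probability density `h` (`sum_eigenvalues_le_specRadius`).

The main point (`exists_integrable_mul_le`) is that `∫ h * (A i x) / x ≥ q i` for every `x` in `L`
with `x ≥ ε * f i`, as in the Friedland–Karlin and Donsker–Varadhan inequalities. With `f = f i`,
`g = g i`, `q = q i` and `l = f * log (x / f)`, convexity of the exponential gives
`A i x / x ≥ (q * f + A i l - q * l) / f`; multiplying by `h = f * g` and integrating, the two terms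
with `l` cancel because `g` is an eigenvector of the adjoint. The hypothesis `x ≥ ε * f` makes `l`
an element of `L`, since then `|l| ≤ |log ε| * f + x`. The tangent inequality is applied before the
operator, so only its positivity matters, not its kernel.

For `s > r (∑ A i)` put `x = (s - ∑ A i)⁻¹ (∑ f i)`. The Neumann series shows that `x ≥ 0`, hence
`s * x = (∑ A i) x + ∑ f i` yields both `x ≥ s⁻¹ * f i` for all `i` and `∑ A i x ≤ s * x`. Therefore
`∑ q i ≤ ∫ h * (∑ A i x) / x ≤ s`. The statement on resolvents is the case of the power series
`p i (z) = ∑ z ^ k / s i ^ (k + 1)`.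
-/

/-! ### Power series in an element of a Banach algebra -/

section BanachAlgebra

open FormalMultilinearSeries Filter Topology
open scoped NNReal

variable {A : Type*} [NormedRing A] [NormedAlgebra ℂ A] [CompleteSpace A]

/-- A power series whose radius of convergence exceeds the spectral radius of `T` converges
absolutely at `T`, by Gelfand's formula. -/
theorem summable_norm_smul_pow_of_spectralRadius_lt (T : A) (c : ℕ → ℂ)
    (h : spectralRadius ℂ T < (ofScalars ℂ c).radius) : Summable fun k => ‖c k • T ^ k‖ := by
  obtain ⟨ρ, hρ, hρc⟩ := ENNReal.lt_iff_exists_nnreal_btwn.1 h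
  have hs : Summable fun k => ‖c k‖ * (ρ : ℝ) ^ k := by
    simpa only [ofScalars_norm] using (ofScalars ℂ c).summable_norm_mul_pow hρc
  have hev : ∀ᶠ k : ℕ in atTop, ‖T ^ k‖ ≤ (ρ : ℝ) ^ k := by
    filter_upwards [(spectrum.pow_nnnorm_pow_one_div_tendsto_nhds_spectralRadius T).eventually_lt_const
      hρ, eventually_gt_atTop 0] with k hk hk0
    have hk0' : (k : ℝ) ≠ 0 := by positivity
    have := ENNReal.rpow_le_rpow hk.le (Nat.cast_nonneg (α := ℝ) k)
    rw [← ENNReal.rpow_mul, one_div, inv_mul_cancel₀ hk0', ENNReal.rpow_one, ENNReal.rpow_natCast,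
      ← ENNReal.coe_pow, ENNReal.coe_le_coe] at this
    exact_mod_cast this
  refine hs.of_norm_bounded_eventually_nat ?_
  filter_upwards [hev] with k hk
  rw [norm_norm, norm_smul]
  gcongr

theorem ofNNReal_le_radius_ofScalars_inv_pow (s : ℝ≥0) :
    (s : ℝ≥0∞) ≤ (ofScalars ℂ fun k => (((s : ℝ) ^ (k + 1))⁻¹ : ℂ)).radius := by
  refine le_radius_of_bound _ ((s : ℝ)⁻¹) fun k => ?_
  rw [ofScalars_norm, norm_inv, norm_pow, Complex.norm_real, NNReal.norm_eq]
  rcases eq_or_ne s 0 with rfl | hs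
  · simp
  · have : (s : ℝ) ≠ 0 := by exact_mod_cast hs
    apply le_of_eq
    field_simp
    rw [pow_succ]

/-- The Neumann series of the resolvent converges outside the spectral disc. -/
theorem hasSum_resolvent_of_spectralRadius_lt (T : A) (s : ℝ≥0) (h : spectralRadius ℂ T < s) :
    HasSum (fun k : ℕ => (((s : ℝ) ^ (k + 1))⁻¹ : ℂ) • T ^ k) (resolvent T ((s : ℝ) : ℂ)) := by
  have hs0 : ((s : ℝ) : ℂ) ≠ 0 := by
    rintro hs
    have : s = 0 := by exact_mod_cast hs
    simp [this] at h
  have hF := (summable_norm_smul_pow_of_spectralRadius_lt T _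
    (h.trans_le (ofNNReal_le_radius_ofScalars_inv_pow s))).of_norm.hasSum
  set F : ℕ → A := fun k => (((s : ℝ) ^ (k + 1))⁻¹ : ℂ) • T ^ k with hFdef
  set S := ∑' k, F k
  have hshift : ((s : ℝ) : ℂ) • S = 1 + T * S := by
    have h1 := (hasSum_nat_add_iff' 1).2 (hF.const_smul ((s : ℝ) : ℂ))
    have h2 := hF.mul_left T
    have hstep : ∀ k, ((s : ℝ) : ℂ) • F (k + 1) = T * F k := by
      intro k
      rw [hFdef, smul_smul, mul_smul_comm, ← pow_succ']
      congr 1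
      field_simp
      rw [← pow_succ']
    have h0 : ((s : ℝ) : ℂ) • F 0 = 1 := by
      simp [hFdef, smul_smul, hs0]
    simp only [hstep, Finset.sum_range_one, h0] at h1
    rw [h2.unique h1]
    abel
  have hcomm : S * T = T * S := by
    rw [← (hF.mul_left T).tsum_eq, ← (hF.mul_right T).tsum_eq]
    refine tsum_congr fun k => ?_
    simp only [hFdef, smul_mul_assoc, mul_smul_comm, pow_mul_comm' T k]
  have hl : (algebraMap ℂ A (s : ℝ) - T) * S = 1 := by
    rw [sub_mul, ← Algebra.smul_def, hshift]; abel
  have hr : S * (algebraMap ℂ A (s : ℝ) - T) = 1 := by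
    rw [mul_sub, ← Algebra.commutes, ← Algebra.smul_def, hshift, hcomm]; abel
  have : resolvent T ((s : ℝ) : ℂ) = S := Ring.inverse_unit ⟨_, S, hl, hr⟩
  rwa [this]

end BanachAlgebra

namespace BanachFunctionSpace

variable {X : Type*} [MeasurableSpace X] {μ : Measure X} {L : BanachFunctionSpace μ}

/-! ### Order and norm on a Banach function space -/

theorem coeFn_add (f g : L) : ((f + g : L) : X →ₘ[μ] ℂ) =ᵐ[μ]
    fun x => (f : X →ₘ[μ] ℂ) x + (g : X →ₘ[μ] ℂ) x :=
  AEEqFun.coeFn_add f.toFun g.toFun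

theorem coeFn_sub (f g : L) : ((f - g : L) : X →ₘ[μ] ℂ) =ᵐ[μ]
    fun x => (f : X →ₘ[μ] ℂ) x - (g : X →ₘ[μ] ℂ) x :=
  AEEqFun.coeFn_sub f.toFun g.toFun

theorem coeFn_smul (c : ℂ) (f : L) : ((c • f : L) : X →ₘ[μ] ℂ) =ᵐ[μ]
    fun x => c * (f : X →ₘ[μ] ℂ) x :=
  AEEqFun.coeFn_smul c f.toFun

theorem coeFn_zero : ((0 : L) : X →ₘ[μ] ℂ) =ᵐ[μ] fun _ => (0 : ℂ) :=
  AEEqFun.coeFn_zero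

theorem le_iff_ae {f g : L} :
    f ≤ g ↔ ∀ᵐ x ∂μ, (f : X →ₘ[μ] ℂ) x ≤ (g : X →ₘ[μ] ℂ) x :=
  AEEqFun.coeFn_le.symm

theorem nonneg_iff_ae {f : L} : 0 ≤ f ↔ ∀ᵐ x ∂μ, 0 ≤ (f : X →ₘ[μ] ℂ) x := by
  rw [le_iff_ae]
  refine Filter.eventually_congr ?_
  filter_upwards [coeFn_zero (L := L)] with x hx
  rw [hx]

theorem exists_ae_eq_of_norm_le (f : L) (w : X → ℂ) (hw : AEStronglyMeasurable w μ)
    (h : ∀ᵐ x ∂μ, ‖w x‖ ≤ ‖(f : X →ₘ[μ] ℂ) x‖) :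
    ∃ W : L, (W : X →ₘ[μ] ℂ) =ᵐ[μ] w ∧ ‖W‖ ≤ ‖f‖ := by
  obtain ⟨hW, hn⟩ := L.ideal f (AEEqFun.mk w hw) (by
    filter_upwards [h, AEEqFun.coeFn_mk w hw] with x hx hx'
    rwa [hx'])
  exact ⟨⟨_, hW⟩, AEEqFun.coeFn_mk w hw, hn⟩

instance : IsOrderedAddMonoid L where
  add_le_add_left a b h c := by
    rw [le_iff_ae] at h ⊢
    filter_upwards [h, coeFn_add a c, coeFn_add b c] with x hx h1 h2
    rw [h1, h2]
    gcongr

theorem norm_sub_max_re_zero_le (z t : ℂ) (ht : 0 ≤ t) : ‖z - (max z.re 0 : ℝ)‖ ≤ ‖z - t‖ := by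
  rw [Complex.nonneg_iff] at ht
  rw [Complex.norm_def, Complex.norm_def]
  refine Real.sqrt_le_sqrt ?_
  simp only [Complex.normSq_apply, Complex.sub_re, Complex.sub_im, Complex.ofReal_re,
    Complex.ofReal_im, ← ht.2]
  rcases max_cases z.re 0 with ⟨h, h'⟩ | ⟨h, h'⟩ <;> rw [h]
  · nlinarith [mul_self_nonneg (z.re - t.re)]
  · nlinarith [mul_nonneg ht.1 (neg_nonneg.2 h'.le), mul_self_nonneg t.re]

/-- The positive cone is closed: the distance of `f x` to `[0, ∞)` is dominated by `|f - g|` for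
every non-negative `g`. -/
theorem isClosed_nonneg : IsClosed {f : L | 0 ≤ f} := by
  refine isClosed_of_closure_subset fun f hf => ?_
  obtain ⟨W, hW, -⟩ := exists_ae_eq_of_norm_le f
    (fun x => (f : X →ₘ[μ] ℂ) x - (max ((f : X →ₘ[μ] ℂ) x).re 0 : ℝ))
    (by
      have := f.toFun.aestronglyMeasurable
      fun_prop)
    (Filter.Eventually.of_forall fun x => by
      simpa using norm_sub_max_re_zero_le ((f : X →ₘ[μ] ℂ) x) 0 le_rfl)
  have hW0 : W = 0 := by
    rw [← norm_le_zero_iff]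
    refine le_of_forall_pos_lt_add fun ε hε => ?_
    obtain ⟨g, hg, hfg⟩ := Metric.mem_closure_iff.1 hf ε hε
    obtain ⟨V, hV, hVn⟩ := exists_ae_eq_of_norm_le (f - g) W W.toFun.aestronglyMeasurable (by
      filter_upwards [hW, coeFn_sub f g, nonneg_iff_ae.1 hg] with x h1 h2 h3
      rw [h1, h2]
      exact norm_sub_max_re_zero_le _ _ h3)
    have : V = W := Subtype.val_injective (AEEqFun.ext hV)
    rw [zero_add, ← this]
    exact hVn.trans_lt (by rwa [← dist_eq_norm])
  rw [Set.mem_ofPred_eq, nonneg_iff_ae]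
  filter_upwards [hW, coeFn_zero (L := L)] with x h1 h2
  rw [hW0, h2, eq_comm, sub_eq_zero] at h1
  rw [h1]
  exact_mod_cast le_max_right _ _

instance : OrderClosedTopology L where
  isClosed_le' := by
    have : {p : L × L | p.1 ≤ p.2} = (fun p => p.2 - p.1) ⁻¹' {f : L | 0 ≤ f} := by
      ext p; simp
    rw [this]
    exact isClosed_nonneg.preimage (continuous_snd.sub continuous_fst)

theorem ofReal_smul_nonneg {c : ℝ} (hc : 0 ≤ c) {f : L} (hf : 0 ≤ f) : 0 ≤ (c : ℂ) • f := by
  rw [nonneg_iff_ae] at hf ⊢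
  filter_upwards [hf, coeFn_smul (c : ℂ) f] with x h1 h2
  rw [h2]
  exact mul_nonneg (by exact_mod_cast hc) h1

theorem IsStrictlyPositive.nonneg {f : L} (hf : IsStrictlyPositive (f : X →ₘ[μ] ℂ)) : 0 ≤ f :=
  nonneg_iff_ae.2 (hf.mono fun _ h => h.le)

/-! ### Power series in a positive operator -/

theorem IsPositiveOperator.pow {K : L →L[ℂ] L} (hK : IsPositiveOperator K) (k : ℕ) :
    IsPositiveOperator (K ^ k) := by
  induction k with
  | zero => intro f hf; simpa using hf
  | succ k ih => intro f hf; rw [pow_succ']; exact hK _ (ih f hf)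

theorem IsPositiveOperator.mono {K : L →L[ℂ] L} (hK : IsPositiveOperator K) {f g : L}
    (h : f ≤ g) : K f ≤ K g := by
  rw [← sub_nonneg, ← map_sub]
  exact hK _ (sub_nonneg.2 h)

theorem IsPositiveOperator.sum {ι : Type*} (s : Finset ι) {K : ι → L →L[ℂ] L}
    (hK : ∀ i, IsPositiveOperator (K i)) : IsPositiveOperator (∑ i ∈ s, K i) := by
  intro f hf
  rw [sum_apply]
  exact Finset.sum_nonneg fun i _ => hK i f hf

theorem IsPositiveOperator.of_hasSum {K T : L →L[ℂ] L} (hK : IsPositiveOperator K) {a : ℕ → ℝ}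
    (ha : ∀ k, 0 ≤ a k) (h : HasSum (fun k => (a k : ℂ) • K ^ k) T) : IsPositiveOperator T := by
  intro f hf
  have := h.mapL (ContinuousLinearMap.apply ℂ L f)
  exact this.nonneg fun k => ofReal_smul_nonneg (ha k) (hK.pow k f hf)

theorem apply_eigenvector_of_hasSum {K T : L →L[ℂ] L} {c : ℕ → ℂ} {r q : ℂ} {f : L}
    (hf : K f = r • f) (h : HasSum (fun k => c k • K ^ k) T)
    (hq : HasSum (fun k => c k * r ^ k) q) : T f = q • f := by
  have hpow : ∀ k, (K ^ k) f = r ^ k • f := by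
    intro k
    induction k with
    | zero => simp
    | succ k ih =>
      rw [pow_succ', mul_apply_eq_comp, ih, map_smul, hf, smul_smul, pow_succ]
  have h1 := h.mapL (ContinuousLinearMap.apply ℂ L f)
  have h2 := hq.smul_const f
  refine h1.unique ?_
  convert h2 using 2 with k
  simp [hpow, smul_smul]

theorem adjoint_eigenvector_of_hasSum {K T : L →L[ℂ] L} {c : ℕ → ℂ} {r q : ℂ}
    {φ : L →L[ℂ] ℂ} (hφ : ∀ w, φ (K w) = r * φ w) (h : HasSum (fun k => c k • K ^ k) T)
    (hq : HasSum (fun k => c k * r ^ k) q) (w : L) : φ (T w) = q * φ w := by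
  have hpow : ∀ k w, φ ((K ^ k) w) = r ^ k * φ w := by
    intro k
    induction k with
    | zero => simp
    | succ k ih =>
      intro w
      rw [pow_succ, mul_apply_eq_comp, ih, hφ, pow_succ, mul_assoc]
  have h1 := (h.mapL (ContinuousLinearMap.apply ℂ L w)).mapL φ
  have h2 := hq.mul_right (φ w)
  have h3 : (fun k => φ (ContinuousLinearMap.apply ℂ L w (c k • K ^ k))) =
      fun k => c k * r ^ k * φ w := by
    ext k
    change φ (c k • (K ^ k) w) = _
    rw [map_smul, hpow, smul_eq_mul, mul_assoc]
  rw [h3] at h1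
  exact h1.unique h2

theorem functional_smul (c : ℂ) (g : L.associate) (w : L) :
    L.functional (c • g) w = c * L.functional g w := by
  have h1 : ∀ g : L.associate, L.functional g w =
      ∫ p, (w : X →ₘ[μ] ℂ) p * (g : X →ₘ[μ] ℂ) p ∂μ := fun _ => rfl
  rw [h1, h1, ← integral_const_mul]
  refine integral_congr_ae ?_
  filter_upwards [AEEqFun.coeFn_smul c (g : X →ₘ[μ] ℂ)] with p hp
  simp [hp, mul_left_comm]

/-! ### The entropy estimate -/

theorem abs_mul_log_div_le {ε a b : ℝ} (hε : 0 < ε) (ha : 0 < a) (h : ε * a ≤ b) :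
    |a * Real.log (b / a)| ≤ |Real.log ε| * a + b := by
  have hb : 0 < b := (mul_pos hε ha).trans_le h
  have hlog : Real.log ε ≤ Real.log (b / a) := Real.log_le_log hε ((le_div_iff₀ ha).2 h)
  have hup : a * Real.log (b / a) ≤ b := by
    have := mul_le_mul_of_nonneg_left (Real.log_le_self (div_pos hb ha).le) ha.le
    rwa [mul_div_cancel₀ _ ha.ne'] at this
  have hlow := mul_le_mul_of_nonneg_left ((neg_abs_le _).trans hlog) ha.le
  have := mul_nonneg (abs_nonneg (Real.log ε)) ha.le
  rw [abs_le]
  constructor <;> linarith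

/-- The tangent to the exponential at `q`, in homogeneous form. -/
theorem exp_mul_le_of_pos {a b : ℝ} (ha : 0 < a) (hb : 0 < b) (q : ℝ) :
    Real.exp q * (a * Real.log (b / a)) + (Real.exp q - Real.exp q * q) * a ≤ b := by
  have h := mul_le_mul_of_nonneg_left (Real.add_one_le_exp (Real.log (b / a) - q))
    (mul_pos (Real.exp_pos q) ha).le
  rw [Real.exp_sub, Real.exp_log (div_pos hb ha)] at h
  have hq := (Real.exp_pos q).ne'
  have : Real.exp q * a * (b / a / Real.exp q) = b := by field_simp
  linarith

/-- If `A` is positive with strictly positive eigenvectors `u`, `v` on the two sides for the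
eigenvalue `r`, then `u v (A x) / x` has an integrable minorant of integral `r ∫ u v`. With
`l = u log (x / u)`, the minorant is `v (A l + r u - r l)`: it lies below by convexity of the
exponential, and the terms with `l` cancel in its integral because `v` is an eigenvector. -/
theorem exists_integrable_mul_le {A : L →L[ℂ] L} (hA : IsPositiveOperator A) {u x : L}
    (hu : IsStrictlyPositive (u : X →ₘ[μ] ℂ)) {v : L.associate}
    (hv : IsStrictlyPositive (v : X →ₘ[μ] ℂ)) {r : ℝ} (hAu : A u = (r : ℂ) • u)
    (hAv : ∀ w, L.functional v (A w) = r * L.functional v w) {ε : ℝ} (hε : 0 < ε)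
    (hx : (ε : ℂ) • u ≤ x) :
    ∃ F : X → ℝ, Integrable F μ ∧
      ∫ p, F p ∂μ = r * (∫ p, (u : X →ₘ[μ] ℂ) p * (v : X →ₘ[μ] ℂ) p ∂μ).re ∧
      ∀ᵐ p ∂μ, F p * ((x : X →ₘ[μ] ℂ) p).re ≤
        ((u : X →ₘ[μ] ℂ) p * (v : X →ₘ[μ] ℂ) p).re * ((A x : X →ₘ[μ] ℂ) p).re := by
  have hxu : ∀ᵐ p ∂μ, ε * ((u : X →ₘ[μ] ℂ) p).re ≤ ((x : X →ₘ[μ] ℂ) p).re ∧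
      ((x : X →ₘ[μ] ℂ) p).im = 0 := by
    filter_upwards [le_iff_ae.1 hx, coeFn_smul (ε : ℂ) u, hu] with p h1 h2 h3
    rw [h2, Complex.le_def] at h1
    rw [Complex.pos_iff] at h3
    simpa [← h3.2, eq_comm] using h1
  obtain ⟨l, hl, -⟩ := exists_ae_eq_of_norm_le (((|Real.log ε| : ℝ) : ℂ) • u + x)
    (fun p => ((((u : X →ₘ[μ] ℂ) p).re *
      Real.log (((x : X →ₘ[μ] ℂ) p).re / ((u : X →ₘ[μ] ℂ) p).re) : ℝ) : ℂ))
    (by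
      have h1 := u.toFun.aestronglyMeasurable.aemeasurable
      have h2 := x.toFun.aestronglyMeasurable.aemeasurable
      exact AEMeasurable.aestronglyMeasurable (by fun_prop))
    (by
      filter_upwards [hxu, hu, coeFn_add (((|Real.log ε| : ℝ) : ℂ) • u) x,
        coeFn_smul ((|Real.log ε| : ℝ) : ℂ) u] with p h1 h2 h3 h4
      rw [Complex.pos_iff] at h2
      rw [h3, h4, Complex.norm_real, Real.norm_eq_abs]
      refine (abs_mul_log_div_le hε h2.1 h1.1).trans (le_trans (le_of_eq ?_) (Complex.re_le_norm _))
      simp)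
  have hint : ∀ w : L, Integrable (fun p =>
      ((w : X →ₘ[μ] ℂ) p * (v : X →ₘ[μ] ℂ) p).re) μ := fun w => (v.2.1 w).re
  have hintegral : ∀ w : L, ∫ p, ((w : X →ₘ[μ] ℂ) p * (v : X →ₘ[μ] ℂ) p).re ∂μ =
      (L.functional v w).re := fun w => integral_re (v.2.1 w)
  refine ⟨fun p => ((A l : X →ₘ[μ] ℂ) p * (v : X →ₘ[μ] ℂ) p).re
    + r * ((u : X →ₘ[μ] ℂ) p * (v : X →ₘ[μ] ℂ) p).re
    - r * ((l : X →ₘ[μ] ℂ) p * (v : X →ₘ[μ] ℂ) p).re,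
    ((hint _).add ((hint _).const_mul r)).sub ((hint _).const_mul r), ?_, ?_⟩
  · have h1 := integral_sub ((hint (A l)).add ((hint u).const_mul r)) ((hint l).const_mul r)
    have h2 := integral_add (hint (A l)) ((hint u).const_mul r)
    simp only [Pi.add_apply] at h1
    rw [h1, h2, integral_const_mul, integral_const_mul, hintegral, hintegral, hintegral, hAv, Complex.re_ofReal_mul]
    have : L.functional v u = ∫ p, (u : X →ₘ[μ] ℂ) p * (v : X →ₘ[μ] ℂ) p ∂μ := rfl
    rw [← this]
    ring
  -- The tangent inequality passes through `A` for countably many tangents at once; continuity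
  -- then gives it at the point of tangency `q = log (x / u)`, which varies with the point.
  have htan : ∀ᵐ p ∂μ, ∀ q : ℚ, Real.exp q * ((A l : X →ₘ[μ] ℂ) p).re +
      (Real.exp q - Real.exp q * q) * (r * ((u : X →ₘ[μ] ℂ) p).re) ≤
        ((A x : X →ₘ[μ] ℂ) p).re := by
    refine ae_all_iff.2 fun q => ?_
    set c : ℝ := Real.exp q
    set d : ℝ := Real.exp q - Real.exp q * q
    have hle : (c : ℂ) • l + (d : ℂ) • u ≤ x := by
      rw [le_iff_ae]
      filter_upwards [hxu, hu, hl, coeFn_add ((c : ℂ) • l) ((d : ℂ) • u),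
        coeFn_smul (c : ℂ) l, coeFn_smul (d : ℂ) u] with p h1 h2 h3 h4 h5 h6
      rw [Complex.pos_iff] at h2
      have h7 := exp_mul_le_of_pos h2.1 ((mul_pos hε h2.1).trans_le h1.1) q
      rw [h4, h5, h6, h3, Complex.le_def]
      simpa [← h2.2, h1.2] using h7
    have hAle := hA.mono hle
    rw [map_add, map_smul, map_smul, hAu, le_iff_ae] at hAle
    filter_upwards [hAle, coeFn_add ((c : ℂ) • A l) ((d : ℂ) • (r : ℂ) • u),
      coeFn_smul (c : ℂ) (A l), coeFn_smul (d : ℂ) ((r : ℂ) • u), coeFn_smul (r : ℂ) u]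
      with p h1 h2 h3 h4 h5
    rw [h2, h3, h4, h5] at h1
    simpa using (Complex.le_def.1 h1).1
  filter_upwards [htan, hxu, hu, hv, hl] with p h1 h2 h3 h4 h5
  rw [Complex.pos_iff] at h3 h4
  have hreal : ∀ q : ℝ, Real.exp q * ((A l : X →ₘ[μ] ℂ) p).re +
      (Real.exp q - Real.exp q * q) * (r * ((u : X →ₘ[μ] ℂ) p).re) ≤
        ((A x : X →ₘ[μ] ℂ) p).re := by
    intro q
    refine Rat.denseRange_cast.induction_on (p := fun q : ℝ => Real.exp q *
      ((A l : X →ₘ[μ] ℂ) p).re + (Real.exp q - Real.exp q * q) *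
        (r * ((u : X →ₘ[μ] ℂ) p).re) ≤ ((A x : X →ₘ[μ] ℂ) p).re) q ?_ h1
    exact isClosed_le (by fun_prop) continuous_const
  have hxpos : 0 < ((x : X →ₘ[μ] ℂ) p).re := (mul_pos hε h3.1).trans_le h2.1
  have h6 := hreal (Real.log (((x : X →ₘ[μ] ℂ) p).re / ((u : X →ₘ[μ] ℂ) p).re))
  rw [Real.exp_log (div_pos hxpos h3.1)] at h6
  have h7 := mul_le_mul_of_nonneg_left h6 (mul_pos h3.1 h4.1).le
  rw [h5]
  simp only [Complex.mul_re, ← h3.2, ← h4.2, Complex.ofReal_re, Complex.ofReal_im, mul_zero,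
    sub_zero]
  refine le_trans (le_of_eq ?_) h7
  have := h3.1.ne'
  field_simp
  ring

/-! ### Sums of operators with a common product of eigenvectors -/

theorem nontrivial_of_one_lt_rank (h : 1 < Module.rank ℂ L) : Nontrivial L :=
  rank_pos_iff_nontrivial.1 (zero_lt_one.trans h)

theorem specRadius_nonneg (T : L →L[ℂ] L) : 0 ≤ specRadius T :=
  ENNReal.toReal_nonneg

section Nontrivial

variable [Nontrivial L]

theorem spectralRadius_ne_top (T : L →L[ℂ] L) : spectralRadius ℂ T ≠ ⊤ :=
  ((spectrum.spectralRadius_le_nnnorm T).trans_lt ENNReal.coe_lt_top).ne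

theorem spectralRadius_lt_of_specRadius_lt {T : L →L[ℂ] L} {s : NNReal}
    (h : specRadius T < s) : spectralRadius ℂ T < s := by
  rw [← ENNReal.ofReal_toReal (spectralRadius_ne_top T)]
  exact (ENNReal.ofReal_lt_coe_iff ENNReal.toReal_nonneg).2 h

theorem summable_mul_specRadius_pow {T : L →L[ℂ] L} {a : ℕ → ℝ} (h : MemPPlus T a) :
    Summable fun k => a k * specRadius T ^ k := by
  have h' : ((spectralRadius ℂ T).toNNReal : ℝ≥0∞) <
      (FormalMultilinearSeries.ofScalars ℂ fun k => (a k : ℂ)).radius := by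
    rw [ENNReal.coe_toNNReal (spectralRadius_ne_top T)]
    exact h.2
  have := FormalMultilinearSeries.summable_norm_mul_pow _ h'
  simpa only [FormalMultilinearSeries.ofScalars_norm, Complex.norm_real, Real.norm_eq_abs,
    abs_of_nonneg (h.1 _)] using! this

/-- Coefficients of the power series whose value at `z` is `(s - z)⁻¹`. -/
theorem memPPlus_inv_pow {T : L →L[ℂ] L} {s : NNReal} (h : specRadius T < s) :
    MemPPlus T fun k => ((s : ℝ) ^ (k + 1))⁻¹ := by
  refine ⟨fun k => by positivity, (spectralRadius_lt_of_specRadius_lt h).trans_le ?_⟩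
  push_cast
  exact ofNNReal_le_radius_ofScalars_inv_pow s

/-- The resolvent vector `x = (s - ∑ A i)⁻¹ ∑ u i` satisfies `∑ A i x ≤ s x` and dominates a
multiple of every `u i`, so integrating `h ∑ (A i x) / x ≤ s h` bounds `∑ r i` by every
`s > r(∑ A i)`. -/
theorem sum_eigenvalues_le_specRadius {n : ℕ} {A : Fin n → L →L[ℂ] L}
    (hA : ∀ i, IsPositiveOperator (A i)) {u : Fin n → L} {v : Fin n → L.associate}
    {h : X →ₘ[μ] ℂ} {r : Fin n → ℝ}
    (hu : ∀ i, IsStrictlyPositive (u i : X →ₘ[μ] ℂ))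
    (hv : ∀ i, IsStrictlyPositive (v i : X →ₘ[μ] ℂ))
    (hAu : ∀ i, A i (u i) = (r i : ℂ) • u i)
    (hAv : ∀ i w, L.functional (v i) (A i w) = r i * L.functional (v i) w)
    (huv : ∀ i, (u i : X →ₘ[μ] ℂ) * (v i : X →ₘ[μ] ℂ) = h)
    (hh : ∫ p, h p ∂μ = 1) :
    ∑ i, r i ≤ specRadius (∑ i, A i) := by
  rcases isEmpty_or_nonempty (Fin n) with hn | ⟨⟨i₀⟩⟩
  · simpa only [Finset.univ_eq_empty, Finset.sum_empty] using specRadius_nonneg _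
  refine le_of_forall_gt_imp_ge_of_dense fun s hs => ?_
  have hs0 : 0 < s := (specRadius_nonneg _).trans_lt hs
  lift s to NNReal using hs0.le
  set B := ∑ i, A i with hB
  have hBpos : IsPositiveOperator B := IsPositiveOperator.sum _ hA
  have hlt := spectralRadius_lt_of_specRadius_lt hs
  have hsum := hasSum_resolvent_of_spectralRadius_lt B s hlt
  set R := resolvent B ((s : ℝ) : ℂ) with hR
  set y := ∑ i, u i with hy
  have hu0 : ∀ i, 0 ≤ u i := fun i => (hu i).nonneg
  have hy0 : 0 ≤ y := Finset.sum_nonneg fun i _ => hu0 i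
  have hRpos : IsPositiveOperator R := by
    refine hBpos.of_hasSum (a := fun k => ((s : ℝ) ^ (k + 1))⁻¹) (fun k => by positivity) ?_
    push_cast
    exact hsum
  have hmem : ((s : ℝ) : ℂ) ∈ resolventSet ℂ B :=
    spectrum.mem_resolventSet_of_spectralRadius_lt (by simpa using hlt)
  have hBR : B (R y) = ((s : ℝ) : ℂ) • R y - y := by
    have h1 : (algebraMap ℂ (L →L[ℂ] L) (s : ℝ) - B) * R = 1 := Ring.mul_inverse_cancel _ hmem
    have h2 := congrArg (fun T : L →L[ℂ] L => T y) h1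
    simp only [sub_mul, ← Algebra.smul_def] at h2
    have h3 : ((s : ℝ) : ℂ) • R y - B (R y) = y := h2
    exact eq_sub_of_add_eq (sub_eq_iff_eq_add'.1 h3).symm
  have hx0 : 0 ≤ R y := hRpos _ hy0
  have hxu : ∀ i, (((s : ℝ)⁻¹ : ℝ) : ℂ) • u i ≤ R y := by
    intro i
    have h1 : u i ≤ ((s : ℝ) : ℂ) • R y := by
      have : ((s : ℝ) : ℂ) • R y = B (R y) + y := by rw [hBR, sub_add_cancel]
      rw [this]
      exact (Finset.single_le_sum (fun j _ => hu0 j) (Finset.mem_univ i)).trans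
        (le_add_of_nonneg_left (hBpos _ hx0))
    have h2 := ofReal_smul_nonneg (inv_nonneg.2 hs0.le) (sub_nonneg.2 h1)
    rwa [smul_sub, smul_smul, ← Complex.ofReal_mul, inv_mul_cancel₀ hs0.ne', Complex.ofReal_one,
      one_smul, sub_nonneg] at h2
  have huv' : ∀ i, (fun p => (u i : X →ₘ[μ] ℂ) p * (v i : X →ₘ[μ] ℂ) p) =ᵐ[μ] h := by
    intro i
    rw [← huv i]
    exact (AEEqFun.coeFn_mul _ _).symm
  choose F hFint hFeq hFle using fun i =>
    exists_integrable_mul_le (hA i) (hu i) (hv i) (hAu i) (hAv i) (inv_pos.2 hs0) (hxu i)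
  have hFeq' : ∀ i, ∫ p, F i p ∂μ = r i := by
    intro i
    rw [hFeq, integral_congr_ae (huv' i), hh, Complex.one_re, mul_one]
  have hhint : Integrable h μ := ((v i₀).2.1 (u i₀)).congr (huv' i₀)
  have hAx : ∀ᵐ p ∂μ, ∑ i, ((A i (R y) : X →ₘ[μ] ℂ) p).re ≤
      s * ((R y : X →ₘ[μ] ℂ) p).re := by
    have h1 : ∀ t : Finset (Fin n), ∀ᵐ p ∂μ, ((∑ i ∈ t, A i (R y) : L) : X →ₘ[μ] ℂ) p =
        ∑ i ∈ t, (A i (R y) : X →ₘ[μ] ℂ) p := by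
      intro t
      induction t using Finset.induction_on with
      | empty =>
        rw [Finset.sum_empty]
        exact coeFn_zero (L := L)
      | insert a t ha ih =>
        rw [Finset.sum_insert ha]
        filter_upwards [ih, coeFn_add (A a (R y)) (∑ i ∈ t, A i (R y))] with p h1 h2
        rw [h2, h1, Finset.sum_insert ha]
    have h2 : ∑ i, A i (R y) ≤ ((s : ℝ) : ℂ) • R y := by
      rw [← sum_apply, ← hB, hBR]
      exact sub_le_self _ hy0
    filter_upwards [h1 Finset.univ, le_iff_ae.1 h2, coeFn_smul ((s : ℝ) : ℂ) (R y)]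
      with p h3 h4 h5
    rw [h3, h5] at h4
    simpa using (Complex.le_def.1 h4).1
  have hbound : ∀ᵐ p ∂μ, ∑ i, F i p ≤ s * (h p).re := by
    filter_upwards [hAx, ae_all_iff.2 hFle, ae_all_iff.2 huv', le_iff_ae.1 (hxu i₀),
      coeFn_smul (((s : ℝ)⁻¹ : ℝ) : ℂ) (u i₀), hu i₀, hv i₀] with p h1 h2 h3 h4 h5 h6 h7
    have hhp : 0 ≤ (h p).re := by
      rw [← h3 i₀]
      exact (Complex.nonneg_iff.1 (mul_pos h6 h7).le).1
    have hxp : 0 < ((R y : X →ₘ[μ] ℂ) p).re := by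
      rw [h5] at h4
      have : (0 : ℂ) < (((s : ℝ)⁻¹ : ℝ) : ℂ) :=
        Complex.zero_lt_real.2 (inv_pos.2 hs0)
      exact (Complex.pos_iff.1 ((mul_pos this h6).trans_le h4)).1
    refine le_of_mul_le_mul_right ?_ hxp
    calc (∑ i, F i p) * ((R y : X →ₘ[μ] ℂ) p).re
        ≤ ∑ i, (h p).re * ((A i (R y) : X →ₘ[μ] ℂ) p).re := by
          rw [Finset.sum_mul]
          refine Finset.sum_le_sum fun i _ => ?_
          rw [← h3 i]
          exact h2 i
      _ ≤ (h p).re * (s * ((R y : X →ₘ[μ] ℂ) p).re) := by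
          rw [← Finset.mul_sum]
          exact mul_le_mul_of_nonneg_left h1 hhp
      _ = _ := by ring
  have hre : ∫ p, (h p).re ∂μ = 1 := by
    have : ∫ p, (h p).re ∂μ = (∫ p, h p ∂μ).re := integral_re hhint
    rw [this, hh, Complex.one_re]
  calc ∑ i, r i = ∫ p, ∑ i, F i p ∂μ := by
        rw [integral_finsetSum _ fun i _ => hFint i]
        simp only [hFeq']
    _ ≤ ∫ p, s * (h p).re ∂μ :=
        integral_mono_ae (integrable_finsetSum _ fun i _ => hFint i)
          (hhint.re.const_mul _) hbound
    _ = s := by rw [integral_const_mul, hre, mul_one]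

end Nontrivial

end BanachFunctionSpace

/-! ### Power series and resolvents -/

theorem theorem2p3 {X : Type*} [MeasurableSpace X] (μ : Measure X) [SigmaFinite μ]
    (L : BanachFunctionSpace μ)
    (hdim : 1 < Module.rank ℂ L) (hcarrier : L.HasFullCarrier) (hFatou : L.IsWeaklyFatou)
    (n : ℕ) (K : Fin n → (L →L[ℂ] L))
    (hpos : ∀ i, BanachFunctionSpace.IsPositiveOperator (K i))
    (hker : ∀ i, BanachFunctionSpace.IsKernelOperator (K i))
    (f : Fin n → L) (g : Fin n → L.associate) (h : X →ₘ[μ] ℂ)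
    (hf : ∀ i, BanachFunctionSpace.IsStrictlyPositive (f i : X →ₘ[μ] ℂ))
    (hg : ∀ i, BanachFunctionSpace.IsStrictlyPositive (g i : X →ₘ[μ] ℂ))
    (hKf : ∀ i, K i (f i) = (BanachFunctionSpace.specRadius (K i) : ℂ) • f i)
    (hKg : ∀ i, BanachFunctionSpace.adjoint (K i) (L.functional (g i)) =
      L.functional ((BanachFunctionSpace.specRadius (K i) : ℂ) • g i))
    (hfg : ∀ i, (f i : X →ₘ[μ] ℂ) * (g i : X →ₘ[μ] ℂ) = h)
    (hh : ∫ x, h x ∂μ = 1) :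
    (∀ a : Fin n → ℕ → ℝ, (∀ i, BanachFunctionSpace.MemPPlus (K i) (a i)) →
      (∀ i, Summable fun k => (a i k : ℂ) • K i ^ k) ∧
      (∀ i, Summable fun k => a i k * BanachFunctionSpace.specRadius (K i) ^ k) ∧
      ∑ i, ∑' k, a i k * BanachFunctionSpace.specRadius (K i) ^ k ≤
        BanachFunctionSpace.specRadius (∑ i, ∑' k, (a i k : ℂ) • K i ^ k)) ∧
    (∀ s : Fin n → ℝ, (∀ i, BanachFunctionSpace.specRadius (K i) < s i) →
      (∀ i, (s i : ℂ) ∈ resolventSet ℂ (K i)) ∧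
      ∑ i, 1 / (s i - BanachFunctionSpace.specRadius (K i)) ≤
        BanachFunctionSpace.specRadius (∑ i, resolvent (K i) (s i : ℂ))) := by
  have := BanachFunctionSpace.nontrivial_of_one_lt_rank hdim
  have hKg' : ∀ i w, L.functional (g i) (K i w) =
      (BanachFunctionSpace.specRadius (K i) : ℂ) * L.functional (g i) w := by
    intro i w
    have h1 : L.functional (g i) (K i w) =
        L.functional ((BanachFunctionSpace.specRadius (K i) : ℂ) • g i) w :=
      congrArg (fun φ : L →L[ℂ] ℂ => φ w) (hKg i)
    rw [h1, BanachFunctionSpace.functional_smul]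
  have hsummable : ∀ a : Fin n → ℕ → ℝ, (∀ i, BanachFunctionSpace.MemPPlus (K i) (a i)) →
      ∀ i, Summable fun k => (a i k : ℂ) • K i ^ k := fun a ha i =>
    (summable_norm_smul_pow_of_spectralRadius_lt _ _ (ha i).2).of_norm
  have hseries : ∀ a : Fin n → ℕ → ℝ, (∀ i, BanachFunctionSpace.MemPPlus (K i) (a i)) →
      ∑ i, ∑' k, a i k * BanachFunctionSpace.specRadius (K i) ^ k ≤
        BanachFunctionSpace.specRadius (∑ i, ∑' k, (a i k : ℂ) • K i ^ k) := by
    intro a ha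
    have hT := fun i => (hsummable a ha i).hasSum
    have hq : ∀ i, HasSum (fun k => (a i k : ℂ) * (BanachFunctionSpace.specRadius (K i) : ℂ) ^ k)
        ((∑' k, a i k * BanachFunctionSpace.specRadius (K i) ^ k : ℝ) : ℂ) := fun i => by
      simpa using Complex.hasSum_ofReal.2
        (BanachFunctionSpace.summable_mul_specRadius_pow (ha i)).hasSum
    exact BanachFunctionSpace.sum_eigenvalues_le_specRadius
      (fun i => (hpos i).of_hasSum (ha i).1 (hT i)) hf hg
      (fun i => BanachFunctionSpace.apply_eigenvector_of_hasSum (hKf i) (hT i) (hq i))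
      (fun i => BanachFunctionSpace.adjoint_eigenvector_of_hasSum (hKg' i) (hT i) (hq i)) hfg hh
  refine ⟨fun a ha => ⟨hsummable a ha,
    fun i => BanachFunctionSpace.summable_mul_specRadius_pow (ha i), hseries a ha⟩, fun s hs => ?_⟩
  have hr0 : ∀ i, 0 ≤ BanachFunctionSpace.specRadius (K i) := fun i =>
    BanachFunctionSpace.specRadius_nonneg _
  lift s to Fin n → NNReal using fun i => (hr0 i).trans (hs i).le
  have hlt := fun i => BanachFunctionSpace.spectralRadius_lt_of_specRadius_lt (hs i)
  refine ⟨fun i => spectrum.mem_resolventSet_of_spectralRadius_lt (by simpa using hlt i), ?_⟩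
  have hmain := hseries (fun i k => ((s i : ℝ) ^ (k + 1))⁻¹)
    fun i => BanachFunctionSpace.memPPlus_inv_pow (hs i)
  have hres : ∀ i, ∑' k : ℕ, ((((s i : ℝ) ^ (k + 1))⁻¹ : ℝ) : ℂ) • K i ^ k =
      resolvent (K i) ((s i : ℝ) : ℂ) := fun i => by
    push_cast
    exact (hasSum_resolvent_of_spectralRadius_lt (K i) (s i) (hlt i)).tsum_eq
  have hgeom : ∀ i, ∑' k : ℕ, ((s i : ℝ) ^ (k + 1))⁻¹ * BanachFunctionSpace.specRadius (K i) ^ k =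
      1 / (s i - BanachFunctionSpace.specRadius (K i)) := by
    intro i
    have hs0 : (0 : ℝ) < s i := (hr0 i).trans_lt (hs i)
    have hsub : (s i : ℝ) - BanachFunctionSpace.specRadius (K i) ≠ 0 := (sub_pos.2 (hs i)).ne'
    have h1 := (hasSum_geometric_of_lt_one (div_nonneg (hr0 i) hs0.le)
      ((div_lt_one hs0).2 (hs i))).mul_left (s i : ℝ)⁻¹
    have h2 : (s i : ℝ)⁻¹ * (1 - BanachFunctionSpace.specRadius (K i) / s i)⁻¹ =
        1 / (s i - BanachFunctionSpace.specRadius (K i)) := by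
      rw [← mul_inv, mul_sub, mul_div_cancel₀ _ hs0.ne', mul_one, one_div]
    rw [← h2, ← h1.tsum_eq]
    refine tsum_congr fun k => ?_
    rw [div_pow, pow_succ]
    field_simp
  simpa only [hres, hgeom] using hmain
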